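/- Let $\mathcal{X}\subset\mathbb{R}^N$ be closed, $c\colon\mathcal{X}\times\mathcal{X}\to[0,\infty)$ and $f\colon\mathcal{X}\to\mathbb{R}^M$ continuous, $r\in\mathbb{R}^M$, $\tilde f=f-r$, and let $\mu_1,\mu_2$ be Borel probability measures on $\mathcal{X}$. For $r'\in\mathbb{R}^M$ let $\mathcal{P}_{f,r'}$ be the set of Borel probability measures $\mu$ on $\mathcal{X}$ with $\langle\mu,f_i\rangle=r'_i$ for $1\le i\le M$, where $\langle\mu,g\rangle=\int g\,d\mu$; let $\Gamma(\mu_1,\mu)$ be the set of probability measures on $\mathcal{X}\times\mathcal{X}$ with marginals $\mu_1$ and $\mu$; and put $$d(\mu_1,\mathcal{P}_{f,r})=\inf\{\langle\gamma,c\rangle:\gamma\in\Gamma(\mu_1,\mu),\ \mu\in\mathcal{P}_{f,r}\}.$$ For $\lambda\in\mathbb{R}^M$ and a real-valued measurable $\mu_1$-integrable function $\psi$ on $\mathcal{X}$ let $$\varphi^*(\psi,\lambda)=\inf_\gamma\ \langle\gamma,c\rangle-\langle\gamma_1-\mu_1,\psi\rangle-\langle\gamma_2,\lambda^{\mathsf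 T}\tilde f\rangle,$$ the infimum being over all probability measures $\gamma$ on $\mathcal{X}\times\mathcal{X}$, with marginals $\gamma_1,\gamma_2$, for which the terms are finite. Let $d^*=\sup_{\psi,\lambda}\varphi^*(\psi,\lambda)$ and $\psi^\lambda(x)=\inf_{y}[c(x,y)-\lambda^{\mathsf T}\tilde f(y)]\in[-\infty,\infty)$. Assume: (A1) there is an open neighborhood $N(r)$ of $r$ such that $\mathcal{P}_{f,r'}\neq\emptyset$ for all $r'\in N(r)$; (A2) $\mu_1$ and $\mu_2$ have compact support, and for every $r'\in N(r)$ there are $\mu\in\mathcal{P}_{f,r'}$ and $\gamma\in\Gamma(\mu_1,\mu)$. Then: (i) The dual admits the representation $$d^*=\sup_{\psi,\lambda}\bigl\{\langle\mu_1,\psi\rangle:\ \psi(x)+\lambda^{\mathsf T}\tilde f(y)\le c(x,y)\ \text{for all }x,y\in\mathcal{X}\bigr\},$$ the supremum being over real-valued measurable $\mu_1$-integrable $\psi$ and $\lambda\in\mathbb{R}^M$, and the equivalent max-min form $$d^*=\sup_\lambda\int\inf_y\,[c(x,y)-\lambda^{\mathsf T}\tilde f(y)]\,\mu_1(dx),$$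 the supremum being over those $\lambda\in\mathbb{R}^M$ for which $\psi^\lambda$ is real-valued, i.e. $\psi^\lambda(x)>-\infty$ for every $x\in\mathcal{X}$ (the integral may be $-\infty$). If measurable $\psi\colon\mathcal{X}\to[-\infty,\infty)$ are admitted in the constrained supremum, then its value is the supremum of $\int\psi^\lambda\,d\mu_1$ over all $\lambda\in\mathbb{R}^M$. (ii) Suppose in addition that $\mathcal{X}$ is compact. Then the supremum in the max-min form may be taken over all $\lambda\in\mathbb{R}^M$, the infimum defining $d(\mu_1,\mathcal{P}_{f,r})$ is attained, the dual suprema in (i) are attained, and there is no duality gap: there is $\lambda^*\in\mathbb{R}^M$ such that, with $\psi^*(x)=\min_y\{c(x,y)-{\lambda^*}^{\mathsf T}\tilde f(y)\}$ (the minimum being attained for every $x$), the pair $(\psi^*,\lambda^*)$ satisfies the dual constraint, $\varphi^*(\psi^*,\lambda^*)=d^*$, and $$d(\mu_1,\mathcal{P}_{f,r})=d^*=\int\min_y\{c(x,y)-{\lambda^*}^{\mathsf T}\tilde f(y)\}\,\mu_1(dx).$$ -/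

import Mathlib

open MeasureTheory
open scoped NNReal ENNReal Matrix

namespace OTFP

section Definitions

variable {X : Type*} [MeasurableSpace X] {M : ℕ}

/-- The moment class `P_{f,r}`: the probability measures `μ` with `⟨μ, f_i⟩ = r_i` for all `i`
(each `f_i` being `μ`-integrable, so that the moments exist). -/
def momentClass (f : X → Fin M → ℝ) (r : Fin M → ℝ) : Set (ProbabilityMeasure X) :=
  {μ | ∀ i, Integrable (fun x => f x i) (μ : Measure X) ∧ ∫ x, f x i ∂(μ : Measure X) = r i}

/-- `Γ(μ, ν)`: the probability measures on `X × X` with marginals `μ` and `ν`. -/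
def couplings (μ ν : ProbabilityMeasure X) : Set (ProbabilityMeasure (X × X)) :=
  {γ | (γ : Measure (X × X)).fst = (μ : Measure X) ∧ (γ : Measure (X × X)).snd = (ν : Measure X)}

/-- The feasible transport plans: `γ ∈ Γ(μ₁, μ)` for some `μ ∈ P_{f,r}`. -/
def feasiblePlans (μ₁ : ProbabilityMeasure X) (f : X → Fin M → ℝ) (r : Fin M → ℝ) :
    Set (ProbabilityMeasure (X × X)) :=
  {γ | ∃ μ ∈ momentClass f r, γ ∈ couplings μ₁ μ}

/-- The transport cost `⟨γ, c⟩ ∈ [0, ∞]` of a nonnegative cost function. -/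
noncomputable def transportCost (c : X × X → ℝ≥0) (γ : ProbabilityMeasure (X × X)) : ℝ≥0∞ :=
  ∫⁻ p, (c p : ℝ≥0∞) ∂(γ : Measure (X × X))

/-- The primal value `d(μ₁, P_{f,r})`: the infimum of `⟨γ, c⟩` over feasible plans. -/
noncomputable def primalValue (c : X × X → ℝ≥0) (μ₁ : ProbabilityMeasure X)
    (f : X → Fin M → ℝ) (r : Fin M → ℝ) : ℝ≥0∞ :=
  ⨅ γ ∈ feasiblePlans μ₁ f r, transportCost c γ

/-- `λᵀ f̃(y)` with `f̃ = f - r`. -/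
def feature (f : X → Fin M → ℝ) (r lam : Fin M → ℝ) (y : X) : ℝ :=
  lam ⬝ᵥ (f y - r)

/-- The real-valued multipliers `ψ` for the first marginal: measurable, with `⟨μ₁, ψ⟩` finite. -/
def multipliers (μ₁ : ProbabilityMeasure X) : Set (X → ℝ) :=
  {ψ | Measurable ψ ∧ Integrable ψ (μ₁ : Measure X)}

/-- The probability measures on `X × X` at which every term of the Lagrangian is finite. -/
def lagrangianDomain (c : X × X → ℝ≥0) (f : X → Fin M → ℝ) (r : Fin M → ℝ)
    (ψ : X → ℝ) (lam : Fin M → ℝ) : Set (ProbabilityMeasure (X × X)) :=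
  {γ | Integrable (fun p => (c p : ℝ)) (γ : Measure (X × X)) ∧
    Integrable ψ (γ : Measure (X × X)).fst ∧
    Integrable (feature f r lam) (γ : Measure (X × X)).snd}

/-- The dual functional
`φ*(ψ, λ) = inf_γ ⟨γ, c⟩ - ⟨γ₁ - μ₁, ψ⟩ - ⟨γ₂, λᵀ f̃⟩`, the infimum being over probability measures
`γ` on `X × X` (with no constraint on the marginals). -/
noncomputable def dualFunctional (c : X × X → ℝ≥0) (μ₁ : ProbabilityMeasure X)
    (f : X → Fin M → ℝ) (r : Fin M → ℝ) (ψ : X → ℝ) (lam : Fin M → ℝ) : EReal :=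
  ⨅ γ ∈ lagrangianDomain c f r ψ lam,
    (((∫ p, (c p : ℝ) ∂(γ : Measure (X × X)))
      - ((∫ x, ψ x ∂(γ : Measure (X × X)).fst) - ∫ x, ψ x ∂(μ₁ : Measure X))
      - ∫ y, feature f r lam y ∂(γ : Measure (X × X)).snd : ℝ) : EReal)

/-- The dual value `d* = sup_{ψ,λ} φ*(ψ, λ)`. -/
noncomputable def dualValue (c : X × X → ℝ≥0) (μ₁ : ProbabilityMeasure X)
    (f : X → Fin M → ℝ) (r : Fin M → ℝ) : EReal :=
  ⨆ ψ ∈ multipliers μ₁, ⨆ lam : Fin M → ℝ, dualFunctional c μ₁ f r ψ lam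

/-- The dual constraint `ψ(x) + λᵀ f̃(y) ≤ c(x, y)` for all `x, y`. -/
def DualFeasible (c : X × X → ℝ≥0) (f : X → Fin M → ℝ) (r : Fin M → ℝ)
    (ψ : X → ℝ) (lam : Fin M → ℝ) : Prop :=
  ∀ x y, ψ x + feature f r lam y ≤ (c (x, y) : ℝ)

/-- The dual constraint for a multiplier `ψ` that may take the value `-∞`
(the value `+∞` is excluded by the constraint itself). -/
def DualFeasibleExt (c : X × X → ℝ≥0) (f : X → Fin M → ℝ) (r : Fin M → ℝ)
    (ψ : X → EReal) (lam : Fin M → ℝ) : Prop :=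
  ∀ x y, ψ x + (feature f r lam y : EReal) ≤ ((c (x, y) : ℝ) : EReal)

/-- `ψ^λ(x) = inf_y [c(x, y) - λᵀ f̃(y)]`, with values in the extended reals. -/
noncomputable def psiLam (c : X × X → ℝ≥0) (f : X → Fin M → ℝ) (r lam : Fin M → ℝ) (x : X) :
    EReal :=
  ⨅ y, (((c (x, y) : ℝ) - feature f r lam y : ℝ) : EReal)

/-- The integral of an extended-real-valued function, as the integral of its positive part minus
that of its negative part (with the convention `∞ - ∞ = -∞`). -/
noncomputable def extIntegral (μ : Measure X) (g : X → EReal) : EReal :=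
  ((∫⁻ x, (g x).toENNReal ∂μ : ℝ≥0∞) : EReal) - ((∫⁻ x, (-(g x)).toENNReal ∂μ : ℝ≥0∞) : EReal)

end Definitions

end OTFP

/-! Point masses collapse the Lagrangian infimum: testing `γ = δ_(x,y)` shows that, if `φ*(ψ, λ)` is
a finite number `d`, then `ψ + (d - ⟨μ₁, ψ⟩)` satisfies the dual constraint and has integral `d`.
Conversely, a feasible `ψ` makes the Lagrangian at least `⟨μ₁, ψ⟩`. This gives the constrained form
of `d*`. For fixed `λ` the largest feasible multiplier is `ψ^λ`, which gives the max-min forms.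

On a compact set the feasible plans are compact, so the primal infimum is attained. The multiplier
`λ*` is a subgradient at `r` of the convex function sending `r'` to the optimal cost with moments
`r'`. It exists because that function is bounded near `r` (`exists_multiplier`). What remains is to
minimize `⟨γ, c - λ*ᵀ f̃⟩` over plans with first marginal `μ₁` only. Plans on graphs of measurable
near-minimizers show that this minimum is at most `∫ ψ* dμ₁` (`le_integral_of_forall_coupling`),
which closes the gap with weak duality. -/

namespace OTFP

/-! ### Integrals of extended-real-valued functions -/

section ExtendedIntegral

variable {X : Type*} [MeasurableSpace X]

lemma extIntegral_mono (μ : Measure X) {g h : X → EReal} (hgh : ∀ x, g x ≤ h x) :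
    extIntegral μ g ≤ extIntegral μ h := by
  refine EReal.sub_le_sub ?_ ?_
  · exact EReal.coe_ennreal_le_coe_ennreal_iff.2
      (lintegral_mono fun x => EReal.toENNReal_le_toENNReal (hgh x))
  · exact EReal.coe_ennreal_le_coe_ennreal_iff.2
      (lintegral_mono fun x => EReal.toENNReal_le_toENNReal (EReal.neg_le_neg_iff.2 (hgh x)))

lemma extIntegral_coe {μ : Measure X} {ψ : X → ℝ} (hψ : Integrable ψ μ) :
    extIntegral μ (fun x => (ψ x : EReal)) = ((∫ x, ψ x ∂μ : ℝ) : EReal) := by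
  have hp : ∫⁻ x, ENNReal.ofReal (ψ x) ∂μ ≠ ⊤ := hψ.lintegral_lt_top.ne
  have hn : ∫⁻ x, ENNReal.ofReal (-ψ x) ∂μ ≠ ⊤ := hψ.neg.lintegral_lt_top.ne
  rw [integral_eq_lintegral_pos_part_sub_lintegral_neg_part hψ, EReal.coe_sub,
    EReal.coe_ennreal_toReal hp, EReal.coe_ennreal_toReal hn]
  rfl

/-- A real-valued function whose positive part is integrable is integrable as soon as its extended
integral is not `-∞`. -/
lemma integrable_of_extIntegral_ne_bot {μ : Measure X} {ψ : X → ℝ} (hψ : Measurable ψ)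
    (hpos : ∫⁻ x, ENNReal.ofReal (ψ x) ∂μ ≠ ⊤)
    (h : extIntegral μ (fun x => (ψ x : EReal)) ≠ ⊥) : Integrable ψ μ := by
  have hneg : ∫⁻ x, ENNReal.ofReal (-ψ x) ∂μ ≠ ⊤ := by
    intro hn
    apply h
    have : ∫⁻ x, (-(ψ x : EReal)).toENNReal ∂μ = ⊤ := hn
    rw [extIntegral, this, EReal.coe_ennreal_top, EReal.sub_top]
  refine ⟨hψ.aestronglyMeasurable, ?_⟩
  rw [hasFiniteIntegral_iff_norm]
  calc ∫⁻ x, ENNReal.ofReal ‖ψ x‖ ∂μ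
      ≤ ∫⁻ x, (ENNReal.ofReal (ψ x) + ENNReal.ofReal (-ψ x)) ∂μ := by
        refine lintegral_mono fun x => ?_
        rcases le_total 0 (ψ x) with hx | hx
        · rw [Real.norm_of_nonneg hx]; exact le_self_add
        · rw [Real.norm_of_nonpos hx]; exact le_add_self
    _ = ∫⁻ x, ENNReal.ofReal (ψ x) ∂μ + ∫⁻ x, ENNReal.ofReal (-ψ x) ∂μ :=
        lintegral_add_left hψ.ennreal_ofReal _
    _ < ⊤ := ENNReal.add_lt_top.2 ⟨hpos.lt_top, hneg.lt_top⟩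

end ExtendedIntegral

/-! ### The dual constraint and its largest solution `ψ^λ` -/

section InfTransform

variable {X : Type*} {M : ℕ} {c : X × X → ℝ≥0} {f : X → Fin M → ℝ} {r lam : Fin M → ℝ} {ψ : X → ℝ}

lemma DualFeasible.le_psiLam (h : DualFeasible c f r ψ lam) (x : X) :
    (ψ x : EReal) ≤ psiLam c f r lam x :=
  le_iInf fun y => EReal.coe_le_coe_iff.2 (by linarith [h x y])

lemma dualFeasible_of_coe_eq_psiLam (h : ∀ x, (ψ x : EReal) = psiLam c f r lam x) :
    DualFeasible c f r ψ lam := fun x y => by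
  have : (ψ x : EReal) ≤ (((c (x, y) : ℝ) - feature f r lam y : ℝ) : EReal) :=
    (h x).trans_le (iInf_le _ y)
  linarith [EReal.coe_le_coe_iff.1 this]

lemma dualFeasibleExt_iff {φ : X → EReal} :
    DualFeasibleExt c f r φ lam ↔ ∀ x, φ x ≤ psiLam c f r lam x := by
  refine forall_congr' fun x => ?_
  rw [psiLam, le_iInf_iff]
  refine forall_congr' fun y => ?_
  rw [EReal.coe_sub, EReal.le_sub_iff_add_le (by simp) (by simp)]

lemma coe_eq_psiLam_of_isLeast
    (h : ∀ x, IsLeast (Set.range fun y => (c (x, y) : ℝ) - feature f r lam y) (ψ x)) (x : X) :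
    (ψ x : EReal) = psiLam c f r lam x := by
  obtain ⟨y, hy⟩ := (h x).1
  refine le_antisymm (le_iInf fun z => EReal.coe_le_coe_iff.2 ((h x).2 ⟨z, rfl⟩)) ?_
  exact (iInf_le _ y).trans_eq (congrArg _ hy)

end InfTransform

/-! ### Eliminating the Lagrangian infimum -/

section WeakDuality

variable {X : Type*} [MeasurableSpace X] {M : ℕ}
  {c : X × X → ℝ≥0} {f : X → Fin M → ℝ} {r lam : Fin M → ℝ} {ψ : X → ℝ}

lemma DualFeasible.integral_add_le (h : DualFeasible c f r ψ lam) {γ : Measure (X × X)}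
    (hc : Integrable (fun p => (c p : ℝ)) γ) (hψ : Integrable ψ γ.fst)
    (hf : Integrable (feature f r lam) γ.snd) :
    ∫ x, ψ x ∂γ.fst + ∫ y, feature f r lam y ∂γ.snd ≤ ∫ p, (c p : ℝ) ∂γ := by
  rw [Measure.fst] at hψ ⊢
  rw [Measure.snd] at hf ⊢
  have hψ' : Integrable (fun p : X × X => ψ p.1) γ := hψ.comp_measurable measurable_fst
  have hf' : Integrable (fun p : X × X => feature f r lam p.2) γ :=
    hf.comp_measurable measurable_snd
  rw [integral_map measurable_fst.aemeasurable hψ.aestronglyMeasurable,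
    integral_map measurable_snd.aemeasurable hf.aestronglyMeasurable, ← integral_add hψ' hf']
  exact integral_mono (hψ'.add hf') hc fun p => h p.1 p.2

lemma DualFeasible.integral_le_dualFunctional (h : DualFeasible c f r ψ lam)
    (μ₁ : ProbabilityMeasure X) :
    ((∫ x, ψ x ∂(μ₁ : Measure X) : ℝ) : EReal) ≤ dualFunctional c μ₁ f r ψ lam := by
  refine le_iInf₂ fun γ hγ => EReal.coe_le_coe_iff.2 ?_
  have := h.integral_add_le hγ.1 hγ.2.1 hγ.2.2
  linarith

lemma dualFunctional_le_dirac [MeasurableSingletonClass X] (μ₁ : ProbabilityMeasure X) (x y : X) :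
    dualFunctional c μ₁ f r ψ lam ≤
      (((c (x, y) : ℝ) - (ψ x - ∫ x, ψ x ∂(μ₁ : Measure X)) - feature f r lam y : ℝ) : EReal) := by
  have hfst : (Measure.dirac (x, y)).fst = Measure.dirac x :=
    Measure.map_dirac' measurable_fst _
  have hsnd : (Measure.dirac (x, y)).snd = Measure.dirac y :=
    Measure.map_dirac' measurable_snd _
  let γ : ProbabilityMeasure (X × X) := ⟨Measure.dirac (x, y), inferInstance⟩
  have hγ : (γ : Measure (X × X)) = Measure.dirac (x, y) := rfl
  refine (iInf₂_le γ ?_).trans_eq ?_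
  · refine ⟨?_, ?_, ?_⟩
    · rw [hγ]; exact integrable_dirac (by simp)
    · rw [hγ, hfst]; exact integrable_dirac (by simp)
    · rw [hγ, hsnd]; exact integrable_dirac (by simp)
  · rw [hγ, hfst, hsnd, integral_dirac, integral_dirac, integral_dirac]

lemma dualFunctional_le_iSup_dualFeasible [MeasurableSingletonClass X]
    (μ₁ : ProbabilityMeasure X) (hψ : ψ ∈ multipliers μ₁) :
    dualFunctional c μ₁ f r ψ lam ≤
      ⨆ ψ ∈ multipliers μ₁, ⨆ lam : Fin M → ℝ, ⨆ _ : DualFeasible c f r ψ lam,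
        ((∫ x, ψ x ∂(μ₁ : Measure X) : ℝ) : EReal) := by
  have hle := dualFunctional_le_dirac (c := c) (f := f) (r := r) (lam := lam) (ψ := ψ) μ₁
  obtain ⟨x₀⟩ := μ₁.nonempty
  rcases eq_or_ne (dualFunctional c μ₁ f r ψ lam) ⊥ with hb | hb
  · rw [hb]; exact bot_le
  have ht : dualFunctional c μ₁ f r ψ lam ≠ ⊤ :=
    ((hle x₀ x₀).trans_lt (EReal.coe_lt_top _)).ne
  lift dualFunctional c μ₁ f r ψ lam to ℝ using ⟨ht, hb⟩ with d
  simp only [EReal.coe_le_coe_iff] at hle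
  -- The shift by `d - ∫ ψ` is the one that turns the point-mass bound into the dual constraint, and
  -- it makes the integral equal to `d` since `μ₁` has mass one.
  have hint : ∫ x, (ψ x + (d - ∫ x, ψ x ∂(μ₁ : Measure X))) ∂(μ₁ : Measure X) = d := by
    rw [integral_add hψ.2 (integrable_const _)]; simp
  refine le_iSup₂_of_le (fun x => ψ x + (d - ∫ x, ψ x ∂(μ₁ : Measure X)))
    ⟨hψ.1.add_const _, hψ.2.add (integrable_const _)⟩ (le_iSup₂_of_le lam (fun x y => ?_) ?_)
  · have := hle x y
    linarith
  · rw [hint]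

theorem dualValue_eq_iSup_dualFeasible [MeasurableSingletonClass X]
    (c : X × X → ℝ≥0) (μ₁ : ProbabilityMeasure X) (f : X → Fin M → ℝ) (r : Fin M → ℝ) :
    dualValue c μ₁ f r =
      ⨆ ψ ∈ multipliers μ₁, ⨆ lam : Fin M → ℝ, ⨆ _ : DualFeasible c f r ψ lam,
        ((∫ x, ψ x ∂(μ₁ : Measure X) : ℝ) : EReal) := by
  refine le_antisymm ?_ ?_
  · exact iSup₂_le fun ψ hψ => iSup_le fun lam => dualFunctional_le_iSup_dualFeasible μ₁ hψ
  · exact iSup₂_mono fun ψ hψ => iSup_mono fun lam => iSup_le fun h =>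
      h.integral_le_dualFunctional μ₁

end WeakDuality

/-! ### The max-min representation -/

section MaxMin

variable {X : Type*} [TopologicalSpace X] {M : ℕ} {c : X × X → ℝ≥0} {f : X → Fin M → ℝ}

lemma continuous_feature (hf : Continuous f) (r lam : Fin M → ℝ) :
    Continuous (feature f r lam) := by
  unfold feature dotProduct
  fun_prop

lemma ae_bddAbove_of_isCompact_support [MeasurableSpace X]
    [SecondCountableTopology X] {μ : Measure X}
    (hμ : IsCompact μ.support) {g : X → ℝ} (hg : Continuous g) :
    ∃ C : ℝ, ∀ᵐ x ∂μ, g x ≤ C := by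
  obtain ⟨C, hC⟩ := hμ.bddAbove_image hg.continuousOn
  refine ⟨C, ?_⟩
  filter_upwards [Measure.support_mem_ae (μ := μ)] with x hx
  exact hC ⟨x, hx, rfl⟩

/-- Fixing one `y₀` bounds `ψ` above by a continuous function, which is bounded on the compact
support. So the positive part is integrable, and only the negative part could make the extended
integral `-∞`. -/
lemma integrable_of_coe_eq_psiLam [MeasurableSpace X] [SecondCountableTopology X]
    (hc : Continuous c) {μ : Measure X} [IsFiniteMeasure μ] (hμ : IsCompact μ.support) {r lam : Fin M → ℝ}
    {ψ : X → ℝ} (hψm : Measurable ψ) (hψ : ∀ x, (ψ x : EReal) = psiLam c f r lam x)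
    (h : extIntegral μ (psiLam c f r lam) ≠ ⊥) : Integrable ψ μ := by
  refine integrable_of_extIntegral_ne_bot hψm ?_ (by simpa only [hψ] using h)
  rcases isEmpty_or_nonempty X with hX | ⟨⟨y₀⟩⟩
  · rw [Measure.eq_zero_of_isEmpty μ]; simp
  obtain ⟨C, hC⟩ := ae_bddAbove_of_isCompact_support hμ
    (g := fun x => (c (x, y₀) : ℝ) - feature f r lam y₀) (by fun_prop)
  have hle : ∫⁻ x, ENNReal.ofReal (ψ x) ∂μ ≤ ∫⁻ _, ENNReal.ofReal C ∂μ := by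
    refine lintegral_mono_ae ?_
    filter_upwards [hC] with x hx
    refine ENNReal.ofReal_le_ofReal (le_trans ?_ hx)
    linarith [dualFeasible_of_coe_eq_psiLam hψ x y₀]
  refine (hle.trans_lt ?_).ne
  rw [lintegral_const]
  exact ENNReal.mul_lt_top ENNReal.ofReal_lt_top (measure_lt_top _ _)

variable [MeasurableSpace X] [BorelSpace X]

lemma measurable_psiLam (hc : Continuous c) (hf : Continuous f) (r lam : Fin M → ℝ) :
    Measurable (psiLam c f r lam) := by
  have hfeat := continuous_feature hf r lam
  -- The infimum is uncountable, so measurability comes from semicontinuity.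
  have : UpperSemicontinuous (psiLam c f r lam) :=
    upperSemicontinuous_iInf fun y => Continuous.upperSemicontinuous
      (continuous_coe_real_ereal.comp (by fun_prop))
  exact this.measurable

theorem dualValue_eq_iSup_extIntegral_psiLam [SecondCountableTopology X] [T1Space X]
    (hc : Continuous c) (hf : Continuous f) (r : Fin M → ℝ)
    (μ₁ : ProbabilityMeasure X) (hμ₁ : IsCompact (μ₁ : Measure X).support) :
    dualValue c μ₁ f r =
      ⨆ lam : Fin M → ℝ, ⨆ _ : ∀ x, psiLam c f r lam x ≠ ⊥,
        extIntegral (μ₁ : Measure X) (psiLam c f r lam) := by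
  rw [dualValue_eq_iSup_dualFeasible]
  refine le_antisymm ?_ ?_
  · refine iSup₂_le fun ψ hψ => iSup₂_le fun lam h => le_iSup₂_of_le lam (fun x hx => ?_) ?_
    · exact EReal.coe_ne_bot (ψ x) (le_bot_iff.1 (hx ▸ h.le_psiLam x))
    · rw [← extIntegral_coe hψ.2]
      exact extIntegral_mono _ h.le_psiLam
  · refine iSup₂_le fun lam hlam => ?_
    -- A value `-∞` contributes nothing to the supremum; otherwise `ψ^λ` is itself an admissible
    -- multiplier.
    rcases eq_or_ne (extIntegral (μ₁ : Measure X) (psiLam c f r lam)) ⊥ with hb | hb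
    · rw [hb]; exact bot_le
    obtain ⟨y₀⟩ := μ₁.nonempty
    have htop : ∀ x, psiLam c f r lam x ≠ ⊤ := fun x =>
      ((iInf_le _ y₀).trans_lt (EReal.coe_lt_top _)).ne
    have hcoe : ∀ x, ((psiLam c f r lam x).toReal : EReal) = psiLam c f r lam x := fun x =>
      EReal.coe_toReal (htop x) (hlam x)
    have hm : Measurable fun x => (psiLam c f r lam x).toReal :=
      (measurable_psiLam hc hf r lam).ereal_toReal
    have hint := integrable_of_coe_eq_psiLam hc hμ₁ hm hcoe hb
    refine le_iSup₂_of_le _ ⟨hm, hint⟩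
      (le_iSup₂_of_le lam (dualFeasible_of_coe_eq_psiLam hcoe) ?_)
    rw [← extIntegral_coe hint]
    simp only [hcoe, le_refl]

theorem iSup_dualFeasibleExt_eq_iSup_psiLam (hc : Continuous c) (hf : Continuous f)
    (r : Fin M → ℝ) (μ : Measure X) :
    (⨆ ψ : X → EReal, ⨆ _ : Measurable ψ, ⨆ lam : Fin M → ℝ,
        ⨆ _ : DualFeasibleExt c f r ψ lam, extIntegral μ ψ) =
      ⨆ lam : Fin M → ℝ, extIntegral μ (psiLam c f r lam) := by
  refine le_antisymm ?_ ?_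
  · exact iSup₂_le fun ψ _ => iSup₂_le fun lam h =>
      le_iSup_of_le lam (extIntegral_mono μ (dualFeasibleExt_iff.1 h))
  · exact iSup_le fun lam => le_iSup₂_of_le _ (measurable_psiLam hc hf r lam)
      (le_iSup₂_of_le lam (dualFeasibleExt_iff.2 fun _ => le_rfl) le_rfl)

end MaxMin

end OTFP

namespace OTFP

/-! ### Supporting hyperplanes -/

section Subgradient

/-- A convex subset of `ℝ^M × ℝ` that contains `Nr × [C, ∞)` for a neighborhood `Nr` of `r` has a
nonvertical supporting hyperplane at `(r, v)`, if the points above `r` are at height at least `v`. -/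
lemma exists_nonvertical_supporting_hyperplane {M : ℕ} {S : Set ((Fin M → ℝ) × ℝ)}
    (hS : Convex ℝ S) {Nr : Set (Fin M → ℝ)} (hNr : IsOpen Nr) {r : Fin M → ℝ} (hr : r ∈ Nr)
    {C : ℝ} (hC : ∀ m ∈ Nr, ∀ t, C ≤ t → (m, t) ∈ S) {v : ℝ} (hv : ∀ t, (r, t) ∈ S → v ≤ t) :
    ∃ lam : Fin M → ℝ, ∀ m t, (m, t) ∈ S → v + lam ⬝ᵥ (m - r) ≤ t := by
  have hvC : v ≤ C := hv C (hC r hr C le_rfl)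
  have hint : (r, C + 1) ∈ interior S :=
    mem_interior.2 ⟨Nr ×ˢ Set.Ioi C, fun p hp => hC p.1 hp.1 p.2 (le_of_lt hp.2),
      hNr.prod isOpen_Ioi, hr, by simp⟩
  have hnot : (r, v) ∉ interior S := by
    intro h
    have hcont : Continuous fun t : ℝ => (r, t) := by fun_prop
    obtain ⟨l, hl, hlS⟩ := exists_Ioc_subset_of_mem_nhds
      ((isOpen_interior.preimage hcont).mem_nhds h) ⟨v - 1, by linarith⟩
    have hmem : (r, (l + v) / 2) ∈ interior S := hlS ⟨by linarith, by linarith⟩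
    linarith [hv _ (interior_subset hmem)]
  obtain ⟨ℓ, hℓ⟩ := geometric_hahn_banach_open_point hS.interior isOpen_interior hnot
  -- Separation only covers the interior; a convex set with nonempty interior lies in the closure of
  -- it.
  have hle : ∀ p ∈ S, ℓ p ≤ ℓ (r, v) := by
    intro p hp
    have hcl : p ∈ closure (interior S) := by
      rw [hS.closure_interior_eq_closure_of_nonempty_interior ⟨_, hint⟩]
      exact subset_closure hp
    exact closure_minimal (fun q hq => (hℓ q hq).le)
      (isClosed_le ℓ.continuous continuous_const) hcl
  set b : ℝ := ℓ (0, 1) with hb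
  have hsplit : ∀ m t, ℓ (m, t) = ℓ (m, 0) + t * b := by
    intro m t
    have : ((m, t) : (Fin M → ℝ) × ℝ) = (m, 0) + t • (0, 1) := by ext <;> simp
    rw [this, map_add, map_smul, smul_eq_mul]
  -- The interior point `(r, C + 1)` lies strictly above `(r, v)`, and `ℓ` is strictly smaller
  -- there, so the hyperplane cannot be vertical.
  have hbneg : b < 0 := by
    have := hℓ _ hint
    rw [hsplit r (C + 1), hsplit r v] at this
    by_contra! hb0
    nlinarith
  refine ⟨fun i => ℓ (Pi.single i 1, 0) / (-b), fun m t hmt => ?_⟩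
  have hdot : (fun i => ℓ (Pi.single i 1, 0) / (-b)) ⬝ᵥ (m - r) =
      (ℓ (m, 0) - ℓ (r, 0)) / (-b) := by
    have hsub : ℓ (m, 0) - ℓ (r, 0) = ℓ (m - r, 0) := by
      rw [← map_sub]; simp
    have hsum : ((m - r, 0) : (Fin M → ℝ) × ℝ) = ∑ i, (m - r) i • (Pi.single i 1, 0) := by
      ext j <;> simp [Prod.fst_sum, Prod.snd_sum, Finset.sum_apply, Pi.single_apply]
    rw [hsub, hsum, map_sum, dotProduct, Finset.sum_div]
    refine Finset.sum_congr rfl fun i _ => ?_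
    rw [map_smul, smul_eq_mul]
    ring
  have h := hle _ hmt
  rw [hsplit m t, hsplit r v] at h
  rw [hdot, ← le_sub_iff_add_le', div_le_iff₀ (neg_pos.2 hbneg)]
  linarith

end Subgradient

/-! ### Compact spaces: attainment and strong duality -/

section Compact

lemma exists_continuous_isLeast {X : Type*} [TopologicalSpace X] [CompactSpace X] [Nonempty X]
    {g : X × X → ℝ} (hg : Continuous g) :
    ∃ ψ : X → ℝ, Continuous ψ ∧ ∀ x, IsLeast (Set.range fun y => g (x, y)) (ψ x) := by
  refine ⟨fun x => sInf ((fun y => g (x, y)) '' Set.univ), ?_, fun x => ?_⟩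
  · exact isCompact_univ.continuous_sInf (f := fun x y => g (x, y)) hg
  · have hcont : Continuous fun y => g (x, y) := by fun_prop
    simp only [Set.image_univ]
    exact (isCompact_range hcont).isLeast_sInf (Set.range_nonempty _)

variable {X : Type*} [MetricSpace X] [CompactSpace X] [MeasurableSpace X] [BorelSpace X] {M : ℕ}
  {c : X × X → ℝ≥0} {f : X → Fin M → ℝ}

lemma integrable_of_continuous {Y : Type*} [TopologicalSpace Y] [CompactSpace Y]
    [MeasurableSpace Y] [OpensMeasurableSpace Y] {g : Y → ℝ} (hg : Continuous g) (μ : Measure Y)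
    [IsFiniteMeasure μ] : Integrable g μ :=
  hg.integrable_of_hasCompactSupport (HasCompactSupport.of_compactSpace g)

lemma mem_feasiblePlans_iff (hf : Continuous f) {r : Fin M → ℝ} {μ₁ : ProbabilityMeasure X}
    {γ : ProbabilityMeasure (X × X)} :
    γ ∈ feasiblePlans μ₁ f r ↔ (γ : Measure (X × X)).fst = μ₁ ∧
      ∀ i, ∫ p, f p.2 i ∂(γ : Measure (X × X)) = r i := by
  have hmap : ∀ i, ∫ y, f y i ∂(γ : Measure (X × X)).snd
      = ∫ p, f p.2 i ∂(γ : Measure (X × X)) := fun i =>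
    integral_map measurable_snd.aemeasurable
      (Continuous.aestronglyMeasurable (by fun_prop))
  constructor
  · rintro ⟨μ, hμ, hfst, hsnd⟩
    exact ⟨hfst, fun i => by rw [← hmap, hsnd, (hμ i).2]⟩
  · rintro ⟨hfst, hmom⟩
    refine ⟨⟨(γ : Measure (X × X)).snd, inferInstance⟩, fun i => ⟨?_, ?_⟩, hfst, rfl⟩
    · exact integrable_of_continuous (by fun_prop) (γ : Measure (X × X)).snd
    · exact (hmap i).trans (hmom i)

/-- Probability measures on a compact metric space form a weakly compact space, and both the
marginal and the moment constraints are weakly closed. -/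
lemma isCompact_feasiblePlans (hf : Continuous f) (r : Fin M → ℝ) (μ₁ : ProbabilityMeasure X) :
    IsCompact (feasiblePlans μ₁ f r) := by
  have hset : feasiblePlans μ₁ f r =
      {γ : ProbabilityMeasure (X × X) | γ.map continuous_fst.measurable.aemeasurable = μ₁} ∩
        ⋂ i, {γ | ∫ p, f p.2 i ∂(γ : Measure (X × X)) = r i} := by
    ext γ
    rw [mem_feasiblePlans_iff hf, Set.mem_inter_iff, Set.mem_iInter]
    exact and_congr_left' (Subtype.ext_iff (a1 := γ.map continuous_fst.measurable.aemeasurable)).symm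
  rw [hset]
  refine IsClosed.isCompact (IsClosed.inter ?_ (isClosed_iInter fun i => ?_))
  · exact isClosed_eq (ProbabilityMeasure.continuous_map continuous_fst) continuous_const
  · exact isClosed_eq (ProbabilityMeasure.continuous_integral_continuousMap
      (⟨fun p => f p.2 i, by fun_prop⟩ : C(X × X, ℝ))) continuous_const

lemma transportCost_eq_ofReal_integral (hc : Continuous c) (γ : ProbabilityMeasure (X × X)) :
    transportCost c γ = ENNReal.ofReal (∫ p, (c p : ℝ) ∂(γ : Measure (X × X))) :=
  lintegral_coe_eq_integral c (integrable_of_continuous (by fun_prop) _)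

lemma exists_transportCost_eq_primalValue (hc : Continuous c) (hf : Continuous f)
    {r : Fin M → ℝ} {μ₁ : ProbabilityMeasure X} (hne : (feasiblePlans μ₁ f r).Nonempty) :
    ∃ γ ∈ feasiblePlans μ₁ f r, transportCost c γ = primalValue c μ₁ f r := by
  have hcont : Continuous (transportCost c) :=
    ProbabilityMeasure.continuous_lintegral_continuousMap (⟨c, hc⟩ : C(X × X, ℝ≥0))
  obtain ⟨γ, hγ, hmin⟩ :=
    (isCompact_feasiblePlans hf r μ₁).exists_isMinOn hne hcont.continuousOn
  exact ⟨γ, hγ, le_antisymm (le_iInf₂ fun γ' hγ' => hmin hγ') (iInf₂_le γ hγ)⟩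

/-- This set lies above the graph of the optimal cost as a function of the moments. Mixing plans
keeps the first marginal and is affine in moments and cost. -/
lemma convex_momentCost (hc : Continuous c) (hf : Continuous f) (μ₁ : ProbabilityMeasure X) :
    Convex ℝ {q : (Fin M → ℝ) × ℝ | ∃ γ ∈ feasiblePlans μ₁ f q.1,
      ∫ p, (c p : ℝ) ∂(γ : Measure (X × X)) ≤ q.2} := by
  rintro ⟨m, t⟩ ⟨γ, hγ, ht⟩ ⟨m', t'⟩ ⟨γ', hγ', ht'⟩ a b ha hb hab
  rw [mem_feasiblePlans_iff hf] at hγ hγ'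
  lift a to ℝ≥0 using ha
  lift b to ℝ≥0 using hb
  have hab' : a + b = 1 := by exact_mod_cast hab
  let ν : Measure (X × X) := a • (γ : Measure (X × X)) + b • (γ' : Measure (X × X))
  have hν : IsProbabilityMeasure ν := ⟨by
    simp only [ν, Measure.add_apply, Measure.smul_apply, measure_univ, ENNReal.smul_def,
      smul_eq_mul, mul_one]
    exact_mod_cast hab'⟩
  have hintegral : ∀ g : X × X → ℝ, Continuous g →
      ∫ p, g p ∂ν = a * ∫ p, g p ∂(γ : Measure (X × X)) + b * ∫ p, g p ∂(γ' : Measure (X × X)) := by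
    intro g hg
    rw [integral_add_measure (integrable_of_continuous hg _) (integrable_of_continuous hg _),
      integral_smul_nnreal_measure, integral_smul_nnreal_measure]
    rfl
  refine ⟨⟨ν, hν⟩, (mem_feasiblePlans_iff hf).2 ⟨?_, fun i => ?_⟩, ?_⟩
  · change ν.fst = _
    have h1 := hγ.1
    have h2 := hγ'.1
    rw [Measure.fst] at h1 h2
    rw [Measure.fst_add, Measure.fst, Measure.fst, Measure.map_smul, Measure.map_smul, h1, h2,
      ← add_smul, hab', one_smul]
  · refine (hintegral _ (by fun_prop)).trans ?_
    rw [hγ.2 i, hγ'.2 i]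
    rfl
  · refine (hintegral _ (by fun_prop)).trans_le ?_
    exact add_le_add (mul_le_mul_of_nonneg_left ht a.2) (mul_le_mul_of_nonneg_left ht' b.2)

lemma integral_feature (hf : Continuous f) (r lam : Fin M → ℝ) (γ : Measure (X × X))
    [IsProbabilityMeasure γ] :
    ∫ p, feature f r lam p.2 ∂γ = lam ⬝ᵥ ((fun i => ∫ p, f p.2 i ∂γ) - r) := by
  unfold feature dotProduct
  rw [integral_finsetSum _ fun i _ => integrable_of_continuous (by fun_prop) _]
  refine Finset.sum_congr rfl fun i _ => ?_
  rw [integral_const_mul]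
  simp only [Pi.sub_apply]
  rw [integral_sub (integrable_of_continuous (by fun_prop) _) (integrable_const _)]
  simp

/-- Existence of a Lagrange multiplier for the moment constraints. -/
lemma exists_multiplier (hc : Continuous c) (hf : Continuous f) {μ₁ : ProbabilityMeasure X}
    {Nr : Set (Fin M → ℝ)} (hNr : IsOpen Nr) {r : Fin M → ℝ} (hr : r ∈ Nr)
    (hne : ∀ r' ∈ Nr, (feasiblePlans μ₁ f r').Nonempty) {v : ℝ}
    (hv : ∀ γ ∈ feasiblePlans μ₁ f r, v ≤ ∫ p, (c p : ℝ) ∂(γ : Measure (X × X))) :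
    ∃ lam : Fin M → ℝ, ∀ γ : ProbabilityMeasure (X × X), (γ : Measure (X × X)).fst = μ₁ →
      v ≤ ∫ p, ((c p : ℝ) - feature f r lam p.2) ∂(γ : Measure (X × X)) := by
  obtain ⟨C, hC⟩ := (isCompact_univ (X := X × X)).bddAbove_image
    (f := fun p => (c p : ℝ)) (by fun_prop)
  have hcC : ∀ γ : ProbabilityMeasure (X × X), ∫ p, (c p : ℝ) ∂(γ : Measure (X × X)) ≤ C := by
    intro γ
    calc ∫ p, (c p : ℝ) ∂(γ : Measure (X × X)) ≤ ∫ _, C ∂(γ : Measure (X × X)) :=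
          integral_mono (integrable_of_continuous (by fun_prop) _) (integrable_const _)
            fun p => hC ⟨p, trivial, rfl⟩
      _ = C := by simp
  obtain ⟨lam, hlam⟩ := exists_nonvertical_supporting_hyperplane
    (convex_momentCost hc hf μ₁) hNr hr (C := C) (v := v)
    (fun m hm t ht => by
      obtain ⟨γ, hγ⟩ := hne m hm
      exact ⟨γ, hγ, (hcC γ).trans ht⟩)
    (fun t ⟨γ, hγ, ht⟩ => (hv γ hγ).trans ht)
  refine ⟨lam, fun γ hγ => ?_⟩
  have hfeat := continuous_feature hf r lam
  have h := hlam (fun i => ∫ p, f p.2 i ∂(γ : Measure (X × X))) _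
    ⟨γ, (mem_feasiblePlans_iff hf).2 ⟨hγ, fun _ => rfl⟩, le_rfl⟩
  rw [integral_sub (integrable_of_continuous (by fun_prop) _)
    (integrable_of_continuous (by fun_prop) _), integral_feature hf]
  linarith

/-- The infimum of `g (x, ·)` is attained up to `ε` by a measurable selection. -/
lemma exists_measurable_almost_minimizer [Nonempty X] {g : X × X → ℝ} (hg : Continuous g)
    {ψ : X → ℝ} (hψ : Continuous ψ) (hmin : ∀ x, ψ x ∈ Set.range fun y => g (x, y))
    {ε : ℝ} (hε : 0 < ε) : ∃ T : X → X, Measurable T ∧ ∀ x, g (x, T x) < ψ x + ε := by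
  classical
  let y : ℕ → X := TopologicalSpace.denseSeq X
  have hex : ∀ x, ∃ n, g (x, y n) < ψ x + ε := by
    intro x
    obtain ⟨z, hz⟩ := hmin x
    have hopen : IsOpen {w | g (x, w) < ψ x + ε} := isOpen_lt (by fun_prop) continuous_const
    obtain ⟨n, hn⟩ := (TopologicalSpace.denseRange_denseSeq X).exists_mem_open hopen
      ⟨z, show g (x, z) < ψ x + ε from hz.trans_lt (lt_add_of_pos_right _ hε)⟩
    exact ⟨n, hn⟩
  -- The first index that works in a dense sequence: a countable-valued choice, measurable because
  -- each condition on `x` is open.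
  refine ⟨fun x => y (Nat.find (hex x)), ?_, fun x => Nat.find_spec (hex x)⟩
  exact (measurable_from_nat (f := y)).comp (measurable_find hex fun k =>
    (isOpen_lt (by fun_prop) (by fun_prop)).measurableSet)

/-- With the second marginal free, mass at `x` can be sent to a near-minimizer `T x`; the plan `(id,
T)_# μ₁` costs at most `∫ ψ + ε`. -/
lemma le_integral_of_forall_coupling {g : X × X → ℝ} (hg : Continuous g)
    {ψ : X → ℝ} (hψ : Continuous ψ) (hmin : ∀ x, ψ x ∈ Set.range fun y => g (x, y))
    {μ₁ : ProbabilityMeasure X} {v : ℝ}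
    (h : ∀ γ : ProbabilityMeasure (X × X), (γ : Measure (X × X)).fst = μ₁ →
      v ≤ ∫ p, g p ∂(γ : Measure (X × X))) :
    v ≤ ∫ x, ψ x ∂(μ₁ : Measure X) := by
  have := μ₁.nonempty
  refine le_of_forall_pos_le_add fun ε hε => ?_
  obtain ⟨T, hT, hTε⟩ := exists_measurable_almost_minimizer hg hψ hmin hε
  have hgraph : Measurable fun x => (x, T x) := measurable_id.prodMk hT
  have hfst : ((μ₁ : Measure X).map fun x => (x, T x)).fst = μ₁ := by
    rw [Measure.fst_map_prodMk hT]
    exact Measure.map_id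
  refine (h (μ₁.map hgraph.aemeasurable) hfst).trans ?_
  rw [ProbabilityMeasure.toMeasure_map, integral_map hgraph.aemeasurable
    hg.aestronglyMeasurable]
  have hint : Integrable (fun x => g (x, T x)) (μ₁ : Measure X) :=
    (integrable_of_continuous hg ((μ₁ : Measure X).map fun x => (x, T x))).comp_measurable hgraph
  have hψi := integrable_of_continuous hψ (μ₁ : Measure X)
  calc ∫ x, g (x, T x) ∂(μ₁ : Measure X) ≤ ∫ x, (ψ x + ε) ∂(μ₁ : Measure X) :=
        integral_mono hint (hψi.add (integrable_const _)) fun x => (hTε x).le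
    _ = ∫ x, ψ x ∂(μ₁ : Measure X) + ε := by
        rw [integral_add hψi (integrable_const _)]; simp

lemma dualValue_le_primalValue (hc : Continuous c) (hf : Continuous f) (r : Fin M → ℝ)
    (μ₁ : ProbabilityMeasure X) : dualValue c μ₁ f r ≤ (primalValue c μ₁ f r : EReal) := by
  rw [dualValue_eq_iSup_dualFeasible]
  refine iSup₂_le fun ψ hψ => iSup₂_le fun lam h => ?_
  -- The primal value lives in `[0, ∞]`, so the comparison is made there with the positive part of
  -- `∫ ψ`, which dominates `∫ ψ`.
  have key : ENNReal.ofReal (∫ x, ψ x ∂(μ₁ : Measure X)) ≤ primalValue c μ₁ f r := by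
    refine le_iInf₂ fun γ hγ => ?_
    rw [transportCost_eq_ofReal_integral hc]
    refine ENNReal.ofReal_le_ofReal ?_
    obtain ⟨hfst, hmom⟩ := (mem_feasiblePlans_iff hf).1 hγ
    have hfeat := continuous_feature hf r lam
    have hle := h.integral_add_le (γ := γ) (integrable_of_continuous (by fun_prop) _)
      (hfst ▸ hψ.2) (integrable_of_continuous hfeat _)
    have hzero : ∫ y, feature f r lam y ∂(γ : Measure (X × X)).snd = 0 := by
      rw [Measure.snd, integral_map measurable_snd.aemeasurable hfeat.aestronglyMeasurable,
        integral_feature hf, funext hmom, sub_self, dotProduct_zero]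
    rwa [hfst, hzero, add_zero] at hle
  refine le_trans ?_ (EReal.coe_ennreal_le_coe_ennreal_iff.2 key)
  rw [EReal.coe_ennreal_ofReal]
  exact EReal.coe_le_coe_iff.2 (le_max_left _ _)

theorem dualValue_eq_iSup_extIntegral_psiLam_of_compactSpace (hc : Continuous c)
    (hf : Continuous f) (r : Fin M → ℝ) (μ₁ : ProbabilityMeasure X) :
    dualValue c μ₁ f r =
      ⨆ lam : Fin M → ℝ, extIntegral (μ₁ : Measure X) (psiLam c f r lam) := by
  have := μ₁.nonempty
  rw [dualValue_eq_iSup_extIntegral_psiLam hc hf r μ₁ (Measure.isClosed_support.isCompact)]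
  refine iSup_congr fun lam => iSup_pos fun x => ?_
  have hfeat := continuous_feature hf r lam
  obtain ⟨ψ, -, hψ⟩ := exists_continuous_isLeast
    (g := fun p : X × X => (c p : ℝ) - feature f r lam p.2) (by fun_prop)
  rw [← coe_eq_psiLam_of_isLeast hψ x]
  exact EReal.coe_ne_bot _

theorem exists_dual_optimizer (hc : Continuous c) (hf : Continuous f)
    {μ₁ : ProbabilityMeasure X} {Nr : Set (Fin M → ℝ)} (hNr : IsOpen Nr) {r : Fin M → ℝ}
    (hr : r ∈ Nr) (hne : ∀ r' ∈ Nr, (feasiblePlans μ₁ f r').Nonempty) :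
    ∃ (lam : Fin M → ℝ) (ψ : X → ℝ),
      (∀ x, IsLeast (Set.range fun y => (c (x, y) : ℝ) - feature f r lam y) (ψ x)) ∧
      ψ ∈ multipliers μ₁ ∧ DualFeasible c f r ψ lam ∧
      (primalValue c μ₁ f r : EReal) ≤ ((∫ x, ψ x ∂(μ₁ : Measure X) : ℝ) : EReal) := by
  have := μ₁.nonempty
  obtain ⟨γ₀, hγ₀, hopt⟩ := exists_transportCost_eq_primalValue hc hf (hne r hr)
  set v := ∫ p, (c p : ℝ) ∂(γ₀ : Measure (X × X)) with hv
  have hnonneg : ∀ γ : ProbabilityMeasure (X × X), 0 ≤ ∫ p, (c p : ℝ) ∂(γ : Measure (X × X)) :=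
    fun γ => integral_nonneg fun p => (c p).2
  obtain ⟨lam, hlam⟩ := exists_multiplier hc hf hNr hr hne (v := v) fun γ hγ => by
    have hle : transportCost c γ₀ ≤ transportCost c γ := hopt.trans_le (iInf₂_le γ hγ)
    rw [transportCost_eq_ofReal_integral hc, transportCost_eq_ofReal_integral hc] at hle
    exact (ENNReal.ofReal_le_ofReal_iff (hnonneg γ)).1 hle
  have hfeat := continuous_feature hf r lam
  have hg : Continuous fun p : X × X => (c p : ℝ) - feature f r lam p.2 := by fun_prop
  obtain ⟨ψ, hψc, hψ⟩ := exists_continuous_isLeast hg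
  refine ⟨lam, ψ, hψ, ⟨hψc.measurable, integrable_of_continuous hψc _⟩,
    dualFeasible_of_coe_eq_psiLam (coe_eq_psiLam_of_isLeast hψ), ?_⟩
  rw [← hopt, transportCost_eq_ofReal_integral hc, EReal.coe_ennreal_ofReal,
    max_eq_left (hnonneg γ₀)]
  exact EReal.coe_le_coe_iff.2
    (le_integral_of_forall_coupling hg hψc (fun x => (hψ x).1) hlam)

end Compact

end OTFP

/-! ### The main theorem -/

theorem proposition1 {N M : ℕ} (X : Set (EuclideanSpace ℝ (Fin N))) (hX : IsClosed X)
    (c : X × X → ℝ≥0) (hc : Continuous c)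
    (f : X → Fin M → ℝ) (hf : Continuous f) (r : Fin M → ℝ)
    (μ₁ μ₂ : ProbabilityMeasure X)
    (Nr : Set (Fin M → ℝ)) (hNr : IsOpen Nr) (hr : r ∈ Nr)
    (hA1 : ∀ r' ∈ Nr, (OTFP.momentClass f r').Nonempty)
    (hμ₁ : IsCompact (μ₁ : Measure X).support) (hμ₂ : IsCompact (μ₂ : Measure X).support)
    (hA2 : ∀ r' ∈ Nr, ∃ γ : ProbabilityMeasure (X × X), ∃ μ : ProbabilityMeasure X,
      μ ∈ OTFP.momentClass f r' ∧ γ ∈ OTFP.couplings μ₁ μ) :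
    -- (i), first representation, over real-valued multipliers
    (OTFP.dualValue c μ₁ f r =
      ⨆ ψ ∈ OTFP.multipliers μ₁, ⨆ lam : Fin M → ℝ, ⨆ _ : OTFP.DualFeasible c f r ψ lam,
        ((∫ x, ψ x ∂(μ₁ : Measure X) : ℝ) : EReal)) ∧
    -- (i), max-min representation, over those `λ` for which `ψ^λ` is real-valued
    (OTFP.dualValue c μ₁ f r =
      ⨆ lam : Fin M → ℝ, ⨆ _ : ∀ x, OTFP.psiLam c f r lam x ≠ ⊥,
        OTFP.extIntegral (μ₁ : Measure X) (OTFP.psiLam c f r lam)) ∧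
    -- (i), max-min representation over all `λ`, multipliers being allowed the value `-∞`
    ((⨆ ψ : X → EReal, ⨆ _ : Measurable ψ, ⨆ lam : Fin M → ℝ,
        ⨆ _ : OTFP.DualFeasibleExt c f r ψ lam, OTFP.extIntegral (μ₁ : Measure X) ψ) =
      ⨆ lam : Fin M → ℝ, OTFP.extIntegral (μ₁ : Measure X) (OTFP.psiLam c f r lam)) ∧
    -- (ii)
    (IsCompact X →
      -- on a compact set the max-min representation of `d*` is over all `λ`
      (OTFP.dualValue c μ₁ f r =
        ⨆ lam : Fin M → ℝ, OTFP.extIntegral (μ₁ : Measure X) (OTFP.psiLam c f r lam)) ∧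
      -- the minimum that defines `d(μ₁, P_{f,r})` is attained
      (∃ γ ∈ OTFP.feasiblePlans μ₁ f r,
        OTFP.transportCost c γ = OTFP.primalValue c μ₁ f r) ∧
      -- no duality gap
      ((OTFP.primalValue c μ₁ f r : EReal) = OTFP.dualValue c μ₁ f r) ∧
      -- dual attainment at `λ*` and `ψ*(x) = min_y {c(x, y) - λ*ᵀ f̃(y)}`
      ∃ (lamStar : Fin M → ℝ) (ψStar : X → ℝ),
        (∀ x, IsLeast (Set.range fun y => (c (x, y) : ℝ) - OTFP.feature f r lamStar y)
          (ψStar x)) ∧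
        ψStar ∈ OTFP.multipliers μ₁ ∧
        OTFP.DualFeasible c f r ψStar lamStar ∧
        OTFP.dualFunctional c μ₁ f r ψStar lamStar = OTFP.dualValue c μ₁ f r ∧
        OTFP.dualValue c μ₁ f r = ((∫ x, ψStar x ∂(μ₁ : Measure X) : ℝ) : EReal)) := by
  have hfeas : ∀ r' ∈ Nr, (OTFP.feasiblePlans μ₁ f r').Nonempty := fun r' hr' => by
    obtain ⟨γ, μ, hμ, hγ⟩ := hA2 r' hr'
    exact ⟨γ, μ, hμ, hγ⟩
  refine ⟨OTFP.dualValue_eq_iSup_dualFeasible c μ₁ f r,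
    OTFP.dualValue_eq_iSup_extIntegral_psiLam hc hf r μ₁ hμ₁,
    OTFP.iSup_dualFeasibleExt_eq_iSup_psiLam hc hf r μ₁, fun hXc => ?_⟩
  have : CompactSpace X := isCompact_iff_compactSpace.1 hXc
  obtain ⟨lam, ψ, hmin, hψ, hdual, hle⟩ := OTFP.exists_dual_optimizer hc hf hNr hr hfeas
  have hweak := OTFP.dualValue_le_primalValue hc hf r μ₁
  have hψle := hdual.integral_le_dualFunctional μ₁
  have hdle : OTFP.dualFunctional c μ₁ f r ψ lam ≤ OTFP.dualValue c μ₁ f r :=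
    le_iSup₂_of_le ψ hψ (le_iSup_of_le lam le_rfl)
  -- All equalities come from the cycle `d* ≤ d(μ₁, P_{f,r}) ≤ ∫ ψ* dμ₁ ≤ φ*(ψ*, λ*) ≤ d*`.
  exact ⟨OTFP.dualValue_eq_iSup_extIntegral_psiLam_of_compactSpace hc hf r μ₁,
    OTFP.exists_transportCost_eq_primalValue hc hf (hfeas r hr),
    le_antisymm (hle.trans (hψle.trans hdle)) hweak,
    lam, ψ, hmin, hψ, hdual, le_antisymm hdle (hweak.trans (hle.trans hψle)),
    le_antisymm (hweak.trans hle) (hψle.trans hdle)⟩
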